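/- Let $G$ be a Polish group and let $H \le G$ be a closed subgroup. For a topological group $K$, a $K$-flow is a compact Hausdorff space equipped with a continuous action $K \times X \to X$, and a $K$-map is a continuous $K$-equivariant map between $K$-flows; $K$ is extremely amenable if every nonempty $K$-flow has a $K$-fixed point. Let $\operatorname{RUC}^b(G/H)$ be the unital commutative $C^*$-algebra (with the supremum norm) of all bounded functions $f \colon G/H \to \mathbb{C}$ such that for every $\varepsilon > 0$ there is a neighbourhood $U$ of $1_G$ with $|f(ux) - f(x)| < \varepsilon$ for all $u \in U$ and $x \in G/H$, and let the Samuel compactification $\operatorname{Sa}(G/H)$ be its Gelfand spectrum, which is a $G$-flow under $(g\cdot p)(f) = p\big(x \mapsto f(gx)\big)$. Then $H$ (with the subspace topology) is extremely amenable if and only if $\operatorname{Sa}(G/H)$ is $G$-projective, i.e. for all $G$-flows $Y, Z$, every $G$-map $\phi \colon \operatorname{Sa}(G/H) \to Y$ and every surjective $G$-map $\pi \colon Z \to Y$ there is a $G$-map $\psi \colon \operatorname{Sa}(G/H) \to Z$ with $\pi \circ \psi = \phi$. -/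

import Mathlib

open scoped Topology BoundedContinuousFunction

universe u v w

/-- The unital C⋆-algebra of bounded right uniformly continuous functions `G ⧸ H → ℂ`, with the
supremum norm: `f` belongs to it iff for every `ε > 0` there is a neighbourhood `U` of `1` in `G`
with `‖f y - f x‖ < ε` whenever `y ∈ U x`. (Such functions are automatically continuous, see
`continuous_of_rightUniformlyContinuous`.) -/
def RUCb (G : Type*) [Group G] [TopologicalSpace G] (H : Subgroup G) :
    StarSubalgebra ℂ ((G ⧸ H) →ᵇ ℂ) where
  carrier := {f | ∀ ε : ℝ, 0 < ε → ∃ U ∈ 𝓝 (1 : G), ∀ u ∈ U, ∀ x : G ⧸ H, ‖f (u • x) - f x‖ < ε}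
  mul_mem' := by
    intro f g hf hg ε hε
    have hC : 0 < ‖f‖ + ‖g‖ + 1 := by positivity
    obtain ⟨U, hU, h1⟩ := hf (ε / (‖f‖ + ‖g‖ + 1)) (by positivity)
    obtain ⟨V, hV, h2⟩ := hg (ε / (‖f‖ + ‖g‖ + 1)) (by positivity)
    refine ⟨U ∩ V, Filter.inter_mem hU hV, fun u hu x => ?_⟩
    have e : (f * g) (u • x) - (f * g) x
        = (f (u • x) - f x) * g (u • x) + f x * (g (u • x) - g x) := by
      simp only [BoundedContinuousFunction.mul_apply]; ring
    have a1 := h1 u hu.1 x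
    have a2 := h2 u hu.2 x
    have b1 := g.norm_coe_le_norm (u • x)
    have b2 := f.norm_coe_le_norm x
    set δ := ε / (‖f‖ + ‖g‖ + 1) with hδ
    have hδp : 0 < δ := by positivity
    have hε' : ε = δ * (‖f‖ + ‖g‖ + 1) := by rw [hδ]; field_simp
    rw [e]
    calc _ ≤ ‖f (u • x) - f x‖ * ‖g (u • x)‖ + ‖f x‖ * ‖g (u • x) - g x‖ := by
            refine (norm_add_le _ _).trans ?_
            rw [norm_mul, norm_mul]
      _ ≤ δ * ‖g‖ + ‖f‖ * δ := by gcongr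
      _ < ε := by rw [hε']; nlinarith
  add_mem' := by
    intro f g hf hg ε hε
    obtain ⟨U, hU, h1⟩ := hf (ε / 2) (by positivity)
    obtain ⟨V, hV, h2⟩ := hg (ε / 2) (by positivity)
    refine ⟨U ∩ V, Filter.inter_mem hU hV, fun u hu x => ?_⟩
    have e : (f + g) (u • x) - (f + g) x = (f (u • x) - f x) + (g (u • x) - g x) := by
      simp only [BoundedContinuousFunction.add_apply]; ring
    rw [e]
    have a1 := h1 u hu.1 x
    have a2 := h2 u hu.2 x
    exact (norm_add_le _ _).trans_lt (by linarith)
  algebraMap_mem' := by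
    intro c ε hε
    refine ⟨Set.univ, Filter.univ_mem, fun u _ x => ?_⟩
    simpa [BoundedContinuousFunction.algebraMap_apply] using hε
  star_mem' := by
    intro f hf ε hε
    obtain ⟨U, hU, h1⟩ := hf ε hε
    refine ⟨U, hU, fun u hu x => ?_⟩
    have := h1 u hu x
    rwa [BoundedContinuousFunction.star_apply, BoundedContinuousFunction.star_apply, ← star_sub,
      norm_star]

/-- Right uniform continuity on `G ⧸ H` implies continuity, so that nothing is lost by taking the
members of `RUCb G H` among the bounded continuous functions. -/
theorem continuous_of_rightUniformlyContinuous {G : Type*} [Group G] [TopologicalSpace G]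
    [IsTopologicalGroup G] {H : Subgroup G} {f : G ⧸ H → ℂ}
    (hf : ∀ ε : ℝ, 0 < ε → ∃ U ∈ 𝓝 (1 : G), ∀ u ∈ U, ∀ x : G ⧸ H, ‖f (u • x) - f x‖ < ε) :
    Continuous f := by
  rw [(QuotientGroup.isQuotientMap_mk (N := H)).continuous_iff, continuous_iff_continuousAt]
  intro g
  refine Metric.tendsto_nhds.2 fun ε hε => ?_
  obtain ⟨U, hU, h⟩ := hf ε hε
  have hc : Filter.Tendsto (fun k : G => k * g⁻¹) (𝓝 g) (𝓝 1) := by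
    have : Continuous fun k : G => k * g⁻¹ := by fun_prop
    simpa using this.tendsto g
  filter_upwards [hc hU] with k hk
  have := h _ hk (g : G ⧸ H)
  rw [dist_eq_norm]
  simpa [MulAction.Quotient.smul_coe] using this

section Samuel

variable {G : Type*} [Group G] [TopologicalSpace G]

theorem RUCb.isClosed (H : Subgroup G) : IsClosed (RUCb G H : Set ((G ⧸ H) →ᵇ ℂ)) := by
  refine isClosed_of_closure_subset fun f hf ε hε => ?_
  obtain ⟨g, hg, hfg⟩ := Metric.mem_closure_iff.1 hf (ε / 3) (by positivity)
  obtain ⟨U, hU, h⟩ := hg (ε / 3) (by positivity)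
  refine ⟨U, hU, fun u hu x => ?_⟩
  have a1 := h u hu x
  have a2 := (BoundedContinuousFunction.dist_coe_le_dist (f := f) (g := g) x).trans_lt hfg
  have a3 := (BoundedContinuousFunction.dist_coe_le_dist (f := f) (g := g) (u • x)).trans_lt hfg
  rw [← dist_eq_norm] at a1 ⊢
  rw [dist_comm (f x)] at a2
  have := dist_triangle4 (f (u • x)) (g (u • x)) (g x) (f x)
  linarith

noncomputable instance (H : Subgroup G) : CompleteSpace (RUCb G H) :=
  (RUCb.isClosed H).completeSpace_coe

/-- The Samuel compactification `Sa(G/H)`: the Gelfand spectrum of the C⋆-algebra `RUCb G H`, i.e.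
the set of its characters with the weak-⋆ topology. -/
def Samuel (G : Type*) [Group G] [TopologicalSpace G] (H : Subgroup G) : Type _ :=
  WeakDual.characterSpace ℂ (RUCb G H)

namespace Samuel

variable {H : Subgroup G}

instance : TopologicalSpace (Samuel G H) :=
  inferInstanceAs (TopologicalSpace (WeakDual.characterSpace ℂ (RUCb G H)))

instance : CompactSpace (Samuel G H) :=
  inferInstanceAs (CompactSpace (WeakDual.characterSpace ℂ (RUCb G H)))

instance : T2Space (Samuel G H) :=
  inferInstanceAs (T2Space (WeakDual.characterSpace ℂ (RUCb G H)))

variable [IsTopologicalGroup G]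

/-- Translation by `g` on functions: `(translate g f) x = f (g • x)`. -/
noncomputable def translate (g : G) : RUCb G H →⋆ₐ[ℂ] RUCb G H where
  toFun f := ⟨f.1.compContinuous ⟨fun x => g • x, continuous_const_smul g⟩, by
    intro ε hε
    obtain ⟨U, hU, h⟩ := f.2 ε hε
    have hc : Filter.Tendsto (fun u : G => g * u * g⁻¹) (𝓝 1) (𝓝 1) := by
      have : Continuous fun u : G => g * u * g⁻¹ := by fun_prop
      simpa using this.tendsto 1
    refine ⟨_, hc hU, fun u hu x => ?_⟩
    have := h _ hu (g • x)
    simpa [smul_smul, mul_assoc] using this⟩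
  map_one' := rfl
  map_mul' _ _ := rfl
  map_zero' := rfl
  map_add' _ _ := rfl
  commutes' _ := rfl
  map_star' _ := rfl

theorem translate_apply (g : G) (f : RUCb G H) (x : G ⧸ H) :
    (translate g f).1 x = f.1 (g • x) := rfl

/-- `G` acts on `Sa(G/H)` by `(g • p) f = p (x ↦ f (g • x))`; on evaluation functionals this is
the translation action of `G` on `G ⧸ H`. -/
noncomputable instance : MulAction G (Samuel G H) where
  smul g p := WeakDual.CharacterSpace.compContinuousMap (translate g) p
  one_smul p := by
    refine Subtype.ext (ContinuousLinearMap.ext fun f => ?_)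
    change p.1 (translate 1 f) = p.1 f
    congr 1
    ext x
    simp [translate_apply]
  mul_smul g h p := by
    refine Subtype.ext (ContinuousLinearMap.ext fun f => ?_)
    change p.1 (translate (g * h) f) = p.1 (translate h (translate g f))
    congr 1
    ext x
    simp [translate_apply, mul_smul]

theorem smul_apply (g : G) (p : Samuel G H) (f : RUCb G H) :
    (g • p).1 f = p.1 (translate g f) := rfl

theorem continuous_translate (f : RUCb G H) : Continuous fun g : G => translate g f := by
  rw [continuous_iff_continuousAt]
  intro g
  refine Metric.tendsto_nhds.2 fun ε hε => ?_
  obtain ⟨U, hU, h⟩ := f.2 (ε / 2) (by positivity)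
  have hc : Filter.Tendsto (fun k : G => k * g⁻¹) (𝓝 g) (𝓝 1) := by
    have : Continuous fun k : G => k * g⁻¹ := by fun_prop
    simpa using this.tendsto g
  filter_upwards [hc hU] with k hk
  refine lt_of_le_of_lt (b := ε / 2) ?_ (by linarith)
  refine (BoundedContinuousFunction.dist_le (by positivity)).2 fun x => ?_
  have := h _ hk (g • x)
  rw [dist_eq_norm]
  simpa [translate_apply, smul_smul] using this.le

instance : ContinuousSMul G (Samuel G H) where
  continuous_smul := by
    refine Continuous.subtype_mk (WeakDual.continuous_of_continuous_eval fun f => ?_) _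
    rw [continuous_iff_continuousAt]
    rintro ⟨g, p⟩
    have hev : Continuous fun q : Samuel G H => q.1 (translate g f) :=
      (WeakDual.eval_continuous _).comp continuous_subtype_val
    refine Metric.tendsto_nhds.2 fun ε hε => ?_
    have h1 := Metric.tendsto_nhds.1 ((continuous_translate f).tendsto g) (ε / 2) (by positivity)
    have h2 := Metric.tendsto_nhds.1 (hev.tendsto p) (ε / 2) (by positivity)
    rw [nhds_prod_eq]
    filter_upwards [h1.prod_mk h2] with q hq
    obtain ⟨hq1, hq2⟩ := hq
    change dist (q.2.1 (translate q.1 f)) (p.1 (translate g f)) < ε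
    have h3 : dist (q.2.1 (translate q.1 f)) (q.2.1 (translate g f)) ≤
        dist (translate q.1 f) (translate g f) := by
      rw [dist_eq_norm, dist_eq_norm, ← map_sub]
      have := (WeakDual.toStrongDual q.2.1).le_opNorm (translate q.1 f - translate g f)
      have h4 := WeakDual.CharacterSpace.norm_le_norm_one q.2
      rw [norm_one] at h4
      calc _ ≤ _ := this
        _ ≤ 1 * _ := by gcongr
        _ = _ := one_mul _
    have := dist_triangle (q.2.1 (translate q.1 f)) (q.2.1 (translate g f)) (p.1 (translate g f))
    linarith

end Samuel

end Samuel

/-- A topological group `G` is extremely amenable if every (nonempty) `G`-flow, i.e. every nonempty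
compact Hausdorff space with a continuous action of `G`, has a fixed point. -/
def IsExtremelyAmenable (G : Type u) [Group G] [TopologicalSpace G] : Prop :=
  ∀ (X : Type v) [TopologicalSpace X] [CompactSpace X] [T2Space X] [Nonempty X]
    [MulAction G X] [ContinuousSMul G X], ∃ x : X, ∀ g : G, g • x = x

/-- A `G`-flow `X` is `G`-projective if every `G`-map `φ : X → Y` to a `G`-flow lifts through every
surjective `G`-map `π : Z → Y` of `G`-flows. -/
def IsGProjective (G : Type u) [Group G] [TopologicalSpace G]
    (X : Type v) [TopologicalSpace X] [CompactSpace X] [T2Space X]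
    [MulAction G X] [ContinuousSMul G X] : Prop :=
  ∀ (Y Z : Type w) [TopologicalSpace Y] [CompactSpace Y] [T2Space Y]
    [MulAction G Y] [ContinuousSMul G Y]
    [TopologicalSpace Z] [CompactSpace Z] [T2Space Z] [MulAction G Z] [ContinuousSMul G Z]
    (φ : X →[G] Y) (π : Z →[G] Y),
    Continuous φ → Continuous π → Function.Surjective π →
      ∃ ψ : X →[G] Z, Continuous ψ ∧ ∀ x, π (ψ x) = φ x

/-! By Gelfand duality, `G`-maps from `Sa(G/H)` to a flow correspond to `H`-fixed points of the
flow, via the image of the base point (`exists_map`, `map_ext`). If `H` is extremely amenable, the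
fibre of `π : Z → Y` over the image of the base point is a nonempty `H`-flow, and a fixed point in
it is a lift. Conversely, lift the identity of `Sa(G/H)` through `Sa(G) → Sa(G/H)`. The image `p` of
the base point is `H`-fixed and, lying over the base point, belongs to the closure of `H` in `Sa(G)`
(`mem_closure_of_map_eq`). In any `H`-flow the limit of `k • x₀` as `k → p` is then fixed
(`exists_fixedPoint_of_mem_closure`). Both facts rest on `RUCb.exists_separating`, which builds
functions on the whole of `G/K` from a Birkhoff–Kakutani pseudometric. -/

section SamuelTheory

open Filter Set

variable {G : Type u} [Group G] [TopologicalSpace G]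

/-! ### Right uniformly continuous functions -/

theorem RUCb.of_bounded [IsTopologicalGroup G] {K : Subgroup G} (f : G ⧸ K → ℂ) (C : ℝ)
    (hC : ∀ x, ‖f x‖ ≤ C)
    (hf : ∀ ε : ℝ, 0 < ε → ∃ U ∈ 𝓝 (1 : G), ∀ u ∈ U, ∀ x : G ⧸ K, ‖f (u • x) - f x‖ < ε) :
    ∃ F : RUCb G K, ∀ x, F.1 x = f x :=
  ⟨⟨BoundedContinuousFunction.ofNormedAddCommGroup f
    (continuous_of_rightUniformlyContinuous hf) C hC, hf⟩, fun _ => rfl⟩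

/-- On a flow, a continuous function is moved uniformly little by group elements near `1`. -/
theorem exists_nhds_one_dist_smul_lt {X : Type*} [TopologicalSpace X] [CompactSpace X]
    [MulAction G X] [ContinuousSMul G X] {E : Type*} [PseudoMetricSpace E] {f : X → E}
    (hf : Continuous f) {ε : ℝ} (hε : 0 < ε) :
    ∃ U ∈ 𝓝 (1 : G), ∀ u ∈ U, ∀ x : X, dist (f (u • x)) (f x) < ε := by
  have h : ∀ᶠ u in 𝓝 (1 : G), ∀ x ∈ (univ : Set X), dist (f (u • x)) (f x) < ε := by
    refine isCompact_univ.eventually_forall_of_forall_eventually fun x _ => ?_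
    have hc : Continuous fun z : G × X => dist (f (z.1 • z.2)) (f z.2) := by fun_prop
    exact (hc.tendsto (1, x)).eventually_lt_const (by simpa using hε)
  exact ⟨_, h, fun u hu x => hu x (mem_univ x)⟩

/-- Birkhoff–Kakutani: a first countable group carries a right uniformly continuous gauge that
vanishes at `1` and equals `1` off a given neighbourhood of `1`. -/
theorem exists_rightUniformlyContinuous_gauge [IsTopologicalGroup G] [FirstCountableTopology G]
    {V : Set G} (hV : V ∈ 𝓝 (1 : G)) :
    ∃ N : G → ℝ, N 1 = 0 ∧ (∀ g, 0 ≤ N g) ∧ (∀ g, N g ≤ 1) ∧ (∀ g ∉ V, N g = 1) ∧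
      ∀ ε > 0, ∃ U ∈ 𝓝 (1 : G), ∀ u ∈ U, ∀ g, |N (u * g) - N g| ≤ ε := by
  let := IsTopologicalGroup.rightUniformSpace G
  have hu : uniformity G = comap (fun p : G × G => p.2 * p.1⁻¹) (𝓝 1) := rfl
  have : (uniformity G).IsCountablyGenerated := by rw [hu]; infer_instance
  let := UniformSpace.pseudoMetricSpace G
  obtain ⟨δ, hδ, hball⟩ := Metric.mem_nhds_iff.1 hV
  -- The pseudometric need not be invariant: `dist g (u * g)` is small uniformly in `g` for `u` near
  -- `1`, by the choice of the right uniformity.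
  refine ⟨fun g => min 1 (dist g 1 / δ), by simp, fun g => by positivity, fun g => min_le_left _ _,
    fun g hg => ?_, fun ε hε => ?_⟩
  · have : δ ≤ dist g 1 := not_lt.1 fun h => hg (hball h)
    exact min_eq_left ((one_le_div hδ).2 this)
  · have := Metric.dist_mem_uniformity (α := G) (mul_pos hε hδ)
    rw [hu] at this
    obtain ⟨U, hU, hUs⟩ := this
    refine ⟨U, hU, fun u hu g => ?_⟩
    have h1 : dist g (u * g) < ε * δ :=
      @hUs (g, u * g) (show u * g * g⁻¹ ∈ U by simpa using hu)
    refine (abs_min_sub_min_le_max _ _ _ _).trans ?_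
    rw [sub_self, abs_zero, ← sub_div, abs_div, abs_of_pos hδ]
    refine max_le hε.le ((div_le_iff₀ hδ).2 ?_)
    exact (abs_dist_sub_le _ _ _).trans (by rw [dist_comm]; exact h1.le)

/-- A subset of `G ⧸ K` and the complement of a uniform neighbourhood of it are separated by a
right uniformly continuous function. -/
theorem RUCb.exists_separating [IsTopologicalGroup G] [FirstCountableTopology G] {K : Subgroup G}
    (A : Set (G ⧸ K)) {V : Set G} (hV : V ∈ 𝓝 (1 : G)) :
    ∃ F : RUCb G K, (∀ x ∈ A, F.1 x = 0) ∧ ∀ x, (∀ v ∈ V, ∀ a ∈ A, v • a ≠ x) → F.1 x = 1 := by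
  obtain ⟨N, N1, N0, Nle, NV, NU⟩ := exists_rightUniformlyContinuous_gauge hV
  classical
  rcases A.eq_empty_or_nonempty with rfl | ⟨a, ha⟩
  · exact ⟨1, by simp, fun x _ => rfl⟩
  -- `S x` collects the `g` that carry some point of `A` to `x`, so the infimum of `N` over it acts
  -- as a distance from `A`.
  let S : G ⧸ K → Set G := fun x => {g | g⁻¹ • x ∈ A}
  have hne : ∀ x, Nonempty (S x) := fun x => by
    induction x using QuotientGroup.induction_on with | _ x
    induction a using QuotientGroup.induction_on with | _ b
    exact ⟨x * b⁻¹, by simpa [S, smul_smul] using ha⟩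
  let f : G ⧸ K → ℝ := fun x => ⨅ g : S x, N g
  have hbdd : ∀ x, BddBelow (range fun g : S x => N g) := fun x =>
    ⟨0, by rintro _ ⟨g, rfl⟩; exact N0 g⟩
  have f0 : ∀ x, 0 ≤ f x := fun x => Real.iInf_nonneg fun g => N0 g
  have f1 : ∀ x, f x ≤ 1 := fun x => (ciInf_le (hbdd x) (hne x).some).trans (Nle _)
  -- Left multiplication by `u` maps `S x` into `S (u • x)`.
  have key : ∀ (u : G) (ε : ℝ) (x : G ⧸ K), (∀ g, N (u * g) ≤ N g + ε) → f (u • x) ≤ f x + ε := by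
    intro u ε x h
    have := hne x
    rw [← sub_le_iff_le_add]
    refine le_ciInf fun g => ?_
    rw [sub_le_iff_le_add]
    refine (ciInf_le (hbdd (u • x)) ⟨u * g, ?_⟩).trans (h g)
    have hg : (g : G)⁻¹ • x ∈ A := g.2
    simpa [S, smul_smul] using hg
  obtain ⟨F, hF⟩ := RUCb.of_bounded (fun x => (f x : ℂ)) 1
    (fun x => by rw [Complex.norm_real, Real.norm_of_nonneg (f0 x)]; exact f1 x) (by
      intro ε hε
      obtain ⟨U, hU, h⟩ := NU (ε / 2) (by positivity)
      refine ⟨U, hU, fun u hu x => ?_⟩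
      have e1 := key u (ε / 2) x fun g => by linarith [abs_le.1 (h u hu g)]
      have e2 := key u⁻¹ (ε / 2) (u • x) fun g => by
        have := abs_le.1 (h u hu (u⁻¹ * g))
        rw [mul_inv_cancel_left] at this
        linarith
      rw [inv_smul_smul] at e2
      rw [← Complex.ofReal_sub, Complex.norm_real, Real.norm_eq_abs, abs_lt]
      constructor <;> linarith)
  refine ⟨F, fun x hx => ?_, fun x hx => ?_⟩
  · rw [hF]
    have : f x ≤ 0 := (ciInf_le (hbdd x) ⟨1, by simpa [S] using hx⟩).trans N1.le
    exact_mod_cast le_antisymm this (f0 x)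
  · rw [hF]
    have := hne x
    have : 1 ≤ f x := le_ciInf fun g =>
      (NV g fun hg => hx g hg _ g.2 (smul_inv_smul _ _)).ge
    exact_mod_cast le_antisymm (f1 x) this

/-! ### The Samuel compactification and its universal property -/

namespace Samuel

variable {K : Subgroup G}

/-- The evaluation character at a point of `G ⧸ K`. -/
noncomputable def ofPoint (x : G ⧸ K) : Samuel G K :=
  WeakDual.CharacterSpace.equivAlgHom.symm
    { toFun := fun f : RUCb G K => f.1 x
      map_one' := rfl
      map_mul' := fun _ _ => rfl
      map_zero' := rfl
      map_add' := fun _ _ => rfl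
      commutes' := fun _ => rfl }

theorem ofPoint_apply (x : G ⧸ K) (f : RUCb G K) : (ofPoint x).1 f = f.1 x := rfl

theorem continuous_apply (f : RUCb G K) : Continuous fun p : Samuel G K => p.1 f :=
  (WeakDual.eval_continuous f).comp continuous_subtype_val

/-- A Urysohn function vanishing on all evaluations is the Gelfand transform of some `a`; then `a`
is zero at every point of `G ⧸ K`, so the function is zero everywhere. -/
theorem denseRange_ofPoint : DenseRange (ofPoint : G ⧸ K → Samuel G K) := by
  have : IsClosed (RUCb G K : Set ((G ⧸ K) →ᵇ ℂ)) := RUCb.isClosed K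
  intro p
  by_contra hp
  obtain ⟨f, hf0, hf1, -⟩ := exists_continuous_zero_one_of_isClosed
    (isClosed_closure (s := range (ofPoint : G ⧸ K → Samuel G K))) (isClosed_singleton (x := p))
    (disjoint_singleton_right.2 hp)
  let F : C(WeakDual.characterSpace ℂ (RUCb G K), ℂ) :=
    ⟨fun q => ((f q : ℝ) : ℂ), Complex.continuous_ofReal.comp f.continuous⟩
  obtain ⟨a, ha⟩ := (gelfandTransform_bijective (RUCb G K)).2 F
  have hap : ∀ q : Samuel G K, q.1 a = ((f q : ℝ) : ℂ) := fun q => DFunLike.congr_fun ha q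
  have : a = 0 := by
    ext x
    rw [← ofPoint_apply, hap, hf0 (subset_closure (mem_range_self x))]
    simp
  have h1 := hap p
  rw [hf1 rfl, this] at h1
  simp at h1

variable [IsTopologicalGroup G]

theorem smul_ofPoint (g : G) (x : G ⧸ K) : g • ofPoint x = ofPoint (g • x) := rfl

section Extension

variable {X : Type*} [TopologicalSpace X] [CompactSpace X] [T2Space X] [MulAction G X]
  [ContinuousSMul G X]

/-- Pullback of continuous functions on a flow along the orbit map of a `K`-fixed point. -/
noncomputable def orbitPullback (x₀ : X) (h : ∀ k ∈ K, k • x₀ = x₀) :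
    C(X, ℂ) →⋆ₐ[ℂ] RUCb G K :=
  have hmk : ∀ a b : G, QuotientGroup.leftRel K a b → a • x₀ = b • x₀ := fun a b hab => by
    have := h _ (QuotientGroup.leftRel_apply.1 hab)
    rw [mul_smul, inv_smul_eq_iff] at this
    exact this.symm
  have hruc : ∀ f : C(X, ℂ), ∀ ε : ℝ, 0 < ε → ∃ U ∈ 𝓝 (1 : G), ∀ u ∈ U, ∀ x : G ⧸ K,
      ‖f (Quotient.lift (· • x₀) hmk (u • x)) - f (Quotient.lift (· • x₀) hmk x)‖ < ε := by
    intro f ε hε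
    obtain ⟨U, hU, hf⟩ := exists_nhds_one_dist_smul_lt (G := G) f.continuous hε
    refine ⟨U, hU, fun u hu x => ?_⟩
    induction x using QuotientGroup.induction_on with | _ g
    have := hf u hu (g • x₀)
    rwa [dist_eq_norm, smul_smul] at this
  { toFun := fun f => ⟨BoundedContinuousFunction.ofNormedAddCommGroup
      (fun x : G ⧸ K => f (Quotient.lift (· • x₀) hmk x))
      (continuous_of_rightUniformlyContinuous (hruc f)) ‖f‖ fun _ => f.norm_coe_le_norm _, hruc f⟩
    map_one' := rfl
    map_mul' := fun _ _ => rfl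
    map_zero' := rfl
    map_add' := fun _ _ => rfl
    commutes' := fun _ => rfl
    map_star' := fun _ => rfl }

/-- Universal property of `Sa(G/K)`: a `K`-fixed point `x₀` of a flow determines a `G`-map sending
the base point to `x₀`. -/
theorem exists_map (x₀ : X) (h : ∀ k ∈ K, k • x₀ = x₀) :
    ∃ ψ : Samuel G K →[G] X, Continuous ψ ∧ ∀ g : G, ψ (ofPoint (g : G ⧸ K)) = g • x₀ := by
  -- Dualize `orbitPullback` and identify the characters of `C(X, ℂ)` with the points of `X`.
  let ψ : Samuel G K → X := fun p => (WeakDual.CharacterSpace.homeoEval X ℂ).symm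
    (WeakDual.CharacterSpace.compContinuousMap (orbitPullback x₀ h) p)
  have hψ : Continuous ψ :=
    (Homeomorph.continuous _).comp (ContinuousMap.continuous _)
  have hpt : ∀ g : G, ψ (ofPoint (g : G ⧸ K)) = g • x₀ := fun g =>
    (Homeomorph.symm_apply_eq _).2 (Subtype.ext (ContinuousLinearMap.ext fun f => rfl))
  refine ⟨⟨ψ, fun g => ?_⟩, hψ, hpt⟩
  refine congr_fun (denseRange_ofPoint.equalizer (hψ.comp (continuous_const_smul g))
    (hψ.const_smul g) (funext fun x => ?_))
  induction x using QuotientGroup.induction_on with | _ k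
  change ψ (g • ofPoint _) = g • ψ (ofPoint _)
  rw [smul_ofPoint, MulAction.Quotient.smul_mk, hpt, hpt, smul_eq_mul, mul_smul]

end Extension

theorem smul_ofPoint_one (k : G) (hk : k ∈ K) :
    k • ofPoint ((1 : G) : G ⧸ K) = ofPoint ((1 : G) : G ⧸ K) := by
  rw [smul_ofPoint, MulAction.Quotient.smul_mk]
  congr 1
  rw [QuotientGroup.eq]
  simpa using hk

/-- Maps out of `Sa(G/K)` are determined by the orbit of the base point. -/
theorem map_ext {X : Type*} [TopologicalSpace X] [T2Space X] [MulAction G X]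
    {φ ψ : Samuel G K →[G] X} (hφ : Continuous φ) (hψ : Continuous ψ)
    (h : φ (ofPoint ((1 : G) : G ⧸ K)) = ψ (ofPoint ((1 : G) : G ⧸ K))) (p : Samuel G K) :
    φ p = ψ p := by
  refine congr_fun (denseRange_ofPoint.equalizer hφ hψ (funext fun x => ?_)) p
  induction x using QuotientGroup.induction_on with | _ g
  have e : ofPoint (g : G ⧸ K) = g • ofPoint ((1 : G) : G ⧸ K) := by
    rw [smul_ofPoint, MulAction.Quotient.smul_mk, smul_eq_mul, mul_one]
  change φ (ofPoint _) = ψ (ofPoint _)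
  rw [e, map_smul, map_smul, h]

/-! ### The closure of `H` in `Sa(G)` -/

/-- The canonical map `Sa(G) → Sa(G/K)`. -/
theorem exists_surjective_map (K : Subgroup G) :
    ∃ π : Samuel G (⊥ : Subgroup G) →[G] Samuel G K, Continuous π ∧ Function.Surjective π ∧
      ∀ g : G, π (ofPoint (g : G ⧸ (⊥ : Subgroup G))) = ofPoint (g : G ⧸ K) := by
  obtain ⟨π, hπ, h⟩ := exists_map (K := (⊥ : Subgroup G)) (ofPoint ((1 : G) : G ⧸ K))
    (fun k hk => by rw [Subgroup.mem_bot.1 hk, one_smul])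
  have h' : ∀ g : G, π (ofPoint (g : G ⧸ (⊥ : Subgroup G))) = ofPoint (g : G ⧸ K) := fun g => by
    rw [h, smul_ofPoint, MulAction.Quotient.smul_mk, smul_eq_mul, mul_one]
  refine ⟨π, hπ, ?_, h'⟩
  rw [← range_eq_univ, ← (isCompact_range hπ).isClosed.closure_eq, ← dense_iff_closure_eq]
  refine denseRange_ofPoint.mono ?_
  rintro _ ⟨x, rfl⟩
  induction x using QuotientGroup.induction_on with | _ g
  exact ⟨_, h' g⟩

/-- A point of `Sa(G)` over the base point of `Sa(G/H)` lies in the closure of `H`. -/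
theorem mem_closure_of_map_eq [FirstCountableTopology G] {H : Subgroup G}
    {π : Samuel G (⊥ : Subgroup G) →[G] Samuel G H} (hπ : Continuous π)
    (h : ∀ g : G, π (ofPoint (g : G ⧸ (⊥ : Subgroup G))) = ofPoint (g : G ⧸ H))
    {p : Samuel G (⊥ : Subgroup G)} (hp : π p = ofPoint ((1 : G) : G ⧸ H)) :
    p ∈ closure (range fun k : H => ofPoint ((k : G) : G ⧸ (⊥ : Subgroup G))) := by
  by_contra hcl
  obtain ⟨f, hf0, hf1, -⟩ := exists_continuous_zero_one_of_isClosed isClosed_closure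
    (isClosed_singleton (x := p)) (disjoint_singleton_right.2 hcl)
  obtain ⟨U, hU, hf⟩ := exists_nhds_one_dist_smul_lt (G := G) f.continuous (half_pos one_pos)
  -- `F` is `0` at the coset `H` and `1` off `U • H`, so a `g` near `p` with `‖F‖ < 1` at its coset
  -- lies in `U * H`. As `f` vanishes on `H`, this forces `f < 1 / 2` at `g`, against `1 / 2 < f`
  -- near `p`.
  obtain ⟨F, hF0, hF1⟩ := RUCb.exists_separating {((1 : G) : G ⧸ H)} hU
  have o1 : IsOpen {q : Samuel G (⊥ : Subgroup G) | 1 / 2 < f q} :=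
    isOpen_lt continuous_const f.continuous
  have o2 : IsOpen {q : Samuel G (⊥ : Subgroup G) | ‖(π q).1 F‖ < 1} :=
    isOpen_lt ((continuous_apply F).comp hπ).norm continuous_const
  obtain ⟨x, hx1, hx2⟩ := denseRange_ofPoint.exists_mem_open (o1.inter o2) ⟨p, by
    simp only [mem_ofPred_eq, hf1 rfl]; norm_num, by
    simp [hp, ofPoint_apply, hF0]⟩
  induction x using QuotientGroup.induction_on with | _ g
  simp only [mem_ofPred_eq, h, ofPoint_apply] at hx1 hx2
  by_cases hg : ∃ u ∈ U, u • ((1 : G) : G ⧸ H) = (g : G ⧸ H)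
  · obtain ⟨u, hu, hug⟩ := hg
    rw [MulAction.Quotient.smul_mk, smul_eq_mul, mul_one, QuotientGroup.eq] at hug
    have h1 := hf u hu (ofPoint ((u⁻¹ * g : G) : G ⧸ (⊥ : Subgroup G)))
    rw [hf0 (subset_closure ⟨⟨_, hug⟩, rfl⟩), smul_ofPoint, MulAction.Quotient.smul_mk,
      smul_eq_mul, mul_inv_cancel_left] at h1
    have := (abs_lt.1 (by simpa using h1)).2
    norm_num at hx1 this
    linarith
  · push Not at hg
    rw [hF1 _ fun v hv a ha => by rw [mem_singleton_iff.1 ha]; exact hg v hv] at hx2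
    simp at hx2

/-- An `H`-fixed point of `Sa(G)` in the closure of `H` yields a fixed point in every `H`-flow. -/
theorem exists_fixedPoint_of_mem_closure [FirstCountableTopology G] {H : Subgroup G}
    {p : Samuel G (⊥ : Subgroup G)} (hfix : ∀ k ∈ H, k • p = p)
    (hp : p ∈ closure (range fun k : H => ofPoint ((k : G) : G ⧸ (⊥ : Subgroup G))))
    (X : Type*) [TopologicalSpace X] [CompactSpace X] [T2Space X] [Nonempty X]
    [MulAction H X] [ContinuousSMul H X] : ∃ x : X, ∀ k : H, k • x = x := by
  obtain ⟨r, hr⟩ : ∃ r : Ultrafilter H,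
      Tendsto (fun k : H => ofPoint ((k : G) : G ⧸ (⊥ : Subgroup G))) r (𝓝 p) := by
    have : (comap (fun k : H => ofPoint ((k : G) : G ⧸ (⊥ : Subgroup G))) (𝓝 p)).NeBot := by
      rw [comap_neBot_iff_frequently]
      exact mem_closure_iff_frequently.1 hp
    exact ⟨Ultrafilter.of _, tendsto_iff_comap.2 (Ultrafilter.of_le _)⟩
  obtain ⟨x₀⟩ := ‹Nonempty X›
  obtain ⟨x, -, hx⟩ := isCompact_univ.ultrafilter_le_nhds (r.map fun k : H => k • x₀) (by simp)
  replace hx : Tendsto (fun k : H => k • x₀) r (𝓝 x) := hx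
  refine ⟨x, fun k => ?_⟩
  by_contra hk
  obtain ⟨f, hf0, hf1, -⟩ := exists_continuous_zero_one_of_isClosed
    (isClosed_singleton (x := x)) (isClosed_singleton (x := k • x))
    (disjoint_singleton.2 (Ne.symm hk))
  obtain ⟨V, hV, hf⟩ := exists_nhds_one_dist_smul_lt (G := H) f.continuous
    (show (0 : ℝ) < 1 / 3 by norm_num)
  obtain ⟨W, hW, hWV⟩ := mem_nhds_subtype (H : Set G) 1 V |>.1 hV
  -- If `b = w * a` with `a`, `b` in `H` and `w ∈ W`, then `w` is in `H`, hence in `V`, and moves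
  -- `f` by less than `1 / 3`. So no `b` with `f (b • x₀) > 2 / 3` is in `W • A`, and `F` separates
  -- the two level sets inside `G`.
  let A : Set (G ⧸ (⊥ : Subgroup G)) :=
    (fun k : H => ((k : G) : G ⧸ (⊥ : Subgroup G))) '' {k | f (k • x₀) < 1 / 3}
  obtain ⟨F, hF0, hF1⟩ := RUCb.exists_separating A hW
  have hsep : ∀ b : H, 2 / 3 < f (b • x₀) → F.1 ((b : G) : G ⧸ (⊥ : Subgroup G)) = 1 := by
    intro b hb
    refine hF1 _ ?_
    rintro w hw _ ⟨a, ha, rfl⟩ hwa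
    rw [MulAction.Quotient.smul_mk, smul_eq_mul, QuotientGroup.eq, Subgroup.mem_bot,
      inv_mul_eq_one] at hwa
    have hwe : w = ((b * a⁻¹ : H) : G) := by
      rw [Subgroup.coe_mul, Subgroup.coe_inv, eq_mul_inv_iff_mul_eq, hwa]
    have h1 := hf (b * a⁻¹) (hWV (by rw [mem_preimage, ← hwe]; exact hw)) (a • x₀)
    rw [smul_smul, inv_mul_cancel_right, Real.dist_eq] at h1
    have := (abs_lt.1 h1).2
    simp only [mem_ofPred_eq] at ha
    linarith
  have lim0 : Tendsto (fun b : H => F.1 ((b : G) : G ⧸ (⊥ : Subgroup G))) r (𝓝 (p.1 F)) :=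
    ((continuous_apply F).tendsto p).comp hr
  -- Since `k • p = p`, the translates `k * b` also tend to `p`. But `b` eventually enters the level
  -- set where `F = 0`, and `k * b` the one where `F = 1`.
  have lim1 : Tendsto (fun b : H => F.1 (((k * b : H) : G) : G ⧸ (⊥ : Subgroup G))) r
      (𝓝 (p.1 F)) := by
    have := ((continuous_apply F).comp (continuous_const_smul (k : G))).tendsto p |>.comp hr
    simp only [Function.comp_apply, hfix k k.2] at this
    exact this
  have e0 : p.1 F = 0 := by
    refine tendsto_nhds_unique_of_eventuallyEq lim0 tendsto_const_nhds ?_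
    filter_upwards [((f.continuous.tendsto x).comp hx).eventually_lt_const
      (show f x < 1 / 3 by rw [hf0 rfl]; norm_num)] with b hb
    exact hF0 _ ⟨b, hb, rfl⟩
  have e1 : p.1 F = 1 := by
    refine tendsto_nhds_unique_of_eventuallyEq lim1 tendsto_const_nhds ?_
    filter_upwards [(((f.continuous.comp (continuous_const_smul k)).tendsto x).comp
      hx).eventually_const_lt (show 2 / 3 < f (k • x) by rw [hf1 rfl]; norm_num)] with b hb
    refine hsep _ ?_
    simpa [mul_smul] using hb
  exact zero_ne_one (e0.symm.trans e1)

end Samuel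

/-! ### The two implications -/

/-- The defining property of extreme amenability holds for flows in every universe. -/
theorem IsExtremelyAmenable.exists_fixedPoint [IsTopologicalGroup G]
    (hG : IsExtremelyAmenable.{u, max u v} G) (X : Type*) [TopologicalSpace X] [CompactSpace X]
    [T2Space X] [Nonempty X] [MulAction G X] [ContinuousSMul G X] :
    ∃ x : X, ∀ g : G, g • x = x := by
  obtain ⟨x₀⟩ := ‹Nonempty X›
  -- `Sa(G)` maps to every nonempty flow, so a fixed point in it suffices; it lives in universe `u`,
  -- and `ULift` brings it to the universe of the hypothesis.
  obtain ⟨ψ, -, -⟩ := Samuel.exists_map (K := (⊥ : Subgroup G)) x₀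
    (fun k hk => by rw [Subgroup.mem_bot.1 hk, one_smul])
  have : Nonempty (Samuel G (⊥ : Subgroup G)) := ⟨Samuel.ofPoint ((1 : G) : G ⧸ (⊥ : Subgroup G))⟩
  have : ContinuousSMul G (ULift.{v} (Samuel G (⊥ : Subgroup G))) :=
    ⟨continuous_uliftUp.comp (continuous_fst.smul (continuous_uliftDown.comp continuous_snd))⟩
  obtain ⟨p, hp⟩ := hG (ULift.{v} (Samuel G (⊥ : Subgroup G)))
  exact ⟨ψ p.down, fun g => by rw [← map_smul, ← ULift.smul_down, hp]⟩

/-- The base point has an `H`-fixed image `y₀`, so `H` acts on the fibre of `π` over `y₀`; a fixed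
point there is the value at the base point of the required lift. -/
theorem isGProjective_samuel_of_isExtremelyAmenable [IsTopologicalGroup G] {H : Subgroup G}
    (hH : IsExtremelyAmenable.{u, max u v} H) : IsGProjective.{u, u, w} G (Samuel G H) := by
  intro Y Z _ _ _ _ _ _ _ _ _ _ φ π hφ hπ hs
  set y₀ := φ (Samuel.ofPoint ((1 : G) : G ⧸ H)) with hy₀
  have hfix : ∀ k : H, (k : G) • y₀ = y₀ := fun k => by
    rw [hy₀, ← map_smul, Samuel.smul_ofPoint_one _ k.2]
  let S : Set Z := π ⁻¹' {y₀}
  have : CompactSpace S := isCompact_iff_compactSpace.1 (isClosed_singleton.preimage hπ).isCompact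
  have : Nonempty S := let ⟨z, hz⟩ := hs y₀; ⟨⟨z, hz⟩⟩
  let : MulAction H S :=
    { smul := fun k z => ⟨(k : G) • z.1, by
        have hz : π z.1 = y₀ := z.2
        rw [mem_preimage, map_smul, hz, hfix]; rfl⟩
      one_smul := fun z => Subtype.ext (one_smul G z.1)
      mul_smul := fun a b z => Subtype.ext (mul_smul (a : G) (b : G) z.1) }
  have : ContinuousSMul H S :=
    ⟨Continuous.subtype_mk ((continuous_subtype_val.comp continuous_fst).smul
      (continuous_subtype_val.comp continuous_snd)) _⟩
  obtain ⟨z, hz⟩ := hH.exists_fixedPoint S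
  obtain ⟨ψ, hψ, hψ1⟩ := Samuel.exists_map (K := H) z.1
    (fun k hk => congr_arg Subtype.val (hz ⟨k, hk⟩))
  refine ⟨ψ, hψ, Samuel.map_ext (φ := π.comp ψ) (hπ.comp hψ) hφ ?_⟩
  change π (ψ _) = _
  rw [hψ1, one_smul]
  exact z.2

/-- Projectivity is used once, to split `Sa(G) → Sa(G/H)`: the section sends the base point to an
`H`-fixed point in the closure of `H`. -/
theorem isExtremelyAmenable_of_isGProjective_samuel [IsTopologicalGroup G]
    [FirstCountableTopology G] {H : Subgroup G}
    (hP : IsGProjective.{u, u, max u w} G (Samuel G H)) : IsExtremelyAmenable.{u, v} H := by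
  obtain ⟨π, hπ, hs, h1⟩ := Samuel.exists_surjective_map H
  have : ContinuousSMul G (ULift.{w} (Samuel G (⊥ : Subgroup G))) :=
    ⟨continuous_uliftUp.comp (continuous_fst.smul (continuous_uliftDown.comp continuous_snd))⟩
  have : ContinuousSMul G (ULift.{w} (Samuel G H)) :=
    ⟨continuous_uliftUp.comp (continuous_fst.smul (continuous_uliftDown.comp continuous_snd))⟩
  obtain ⟨ψ, hψ, h⟩ := hP (ULift.{w} (Samuel G H)) (ULift.{w} (Samuel G (⊥ : Subgroup G)))
    ⟨ULift.up, fun _ _ => rfl⟩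
    ⟨fun p => ULift.up (π p.down), fun g p => congr_arg ULift.up (map_smul π g p.down)⟩
    continuous_uliftUp (continuous_uliftUp.comp (hπ.comp continuous_uliftDown))
    (fun y => let ⟨p, hp⟩ := hs y.down; ⟨⟨p⟩, congr_arg ULift.up hp⟩)
  set b := Samuel.ofPoint ((1 : G) : G ⧸ H)
  intro X _ _ _ _ _ _
  refine Samuel.exists_fixedPoint_of_mem_closure (p := (ψ b).down) (fun k hk => ?_)
    (Samuel.mem_closure_of_map_eq hπ h1 (congr_arg ULift.down (h b))) X
  rw [← ULift.smul_down, ← map_smul, Samuel.smul_ofPoint_one k hk]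

end SamuelTheory

theorem theorem3 (G : Type u) [Group G] [TopologicalSpace G] [IsTopologicalGroup G]
    [PolishSpace G] (H : Subgroup G) (hH : IsClosed (H : Set G)) :
    IsExtremelyAmenable.{u, max u v} H ↔
      IsGProjective.{u, u, max u w} G (Samuel G H) :=
  ⟨isGProjective_samuel_of_isExtremelyAmenable.{u, v},
    isExtremelyAmenable_of_isGProjective_samuel.{u, max u v, w}⟩
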